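/- Let $T$ be a commutative domain, let $n\ge 1$, let $q\in T^{\times}$ be a primitive $n$-th root of unity, and let $a,b,c\in T$. Let $$B=T\langle x,y\rangle/(yx-qxy=a,\ x^n=b,\ y^n=c),$$ and suppose that $B$ is a free $T$-module with basis $\{x^iy^j \mid 0\le i,j\le n-1\}$. For a $T$-basis $z_1,\dots,z_r$ of $B$ let $d(B/T)=\det(\operatorname{tr}(z_iz_j))_{r\times r}\in T$ be the discriminant, where $\operatorname{tr}(s)$ is the trace of the $T$-linear map $B\to B$, $v\mapsto sv$. Put $$m=\prod_{i=2}^{n-1}(1+q+\cdots+q^{i-1})\in T$$ (so $m=1$ when $n\le 2$). Then, for every choice of the basis used to compute $d(B/T)$, there is a unit $u\in T^{\times}$ such that, in $B$, $$d(B/T)=u\,(nm)^{n^2}\bigl((1-q)^nx^ny^n-a^n\bigr)^{n(n-1)}.$$ -/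

import Mathlib

/-- The discriminant `det (tr (z_i z_j))` of a (not necessarily commutative) algebra `A` over `Z`
computed in a `Z`-basis `z`. The trace of an element is the trace of its left multiplication
`l_a : A → A`. The value changes only by a unit of `Z` when the basis changes. -/
noncomputable def ncDiscr (Z : Type*) {A ι : Type*} [CommRing Z] [Ring A] [Algebra Z A]
    [Fintype ι] [DecidableEq ι] (z : Module.Basis ι Z A) : Z :=
  Matrix.det (Matrix.of fun i j : ι => LinearMap.trace Z A (LinearMap.mulLeft Z (z i * z j)))

/-- The defining relations `yx - qxy = a`, `x ^ n = b`, `y ^ n = c` on the free algebra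
`T⟨x, y⟩`, where `x` is the generator `0` and `y` is the generator `1`. -/
inductive QWeylRel {T : Type*} [CommRing T] (n : ℕ) (q a b c : T) :
    FreeAlgebra T (Fin 2) → FreeAlgebra T (Fin 2) → Prop
  | comm : QWeylRel n q a b c
      (FreeAlgebra.ι T 1 * FreeAlgebra.ι T 0 - q • (FreeAlgebra.ι T 0 * FreeAlgebra.ι T 1))
      (algebraMap T (FreeAlgebra T (Fin 2)) a)
  | x_pow : QWeylRel n q a b c
      (FreeAlgebra.ι T 0 ^ n) (algebraMap T (FreeAlgebra T (Fin 2)) b)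
  | y_pow : QWeylRel n q a b c
      (FreeAlgebra.ι T 1 ^ n) (algebraMap T (FreeAlgebra T (Fin 2)) c)

/-- The `T`-algebra `T⟨x, y⟩ / (yx - qxy = a, x ^ n = b, y ^ n = c)`. -/
abbrev QWeylQuot {T : Type*} [CommRing T] (n : ℕ) (q a b c : T) : Type _ :=
  RingQuot (QWeylRel n q a b c)

namespace QWeylQuot

/-- The image of the generator `x`. -/
noncomputable def x {T : Type*} [CommRing T] (n : ℕ) (q a b c : T) : QWeylQuot n q a b c :=
  RingQuot.mkAlgHom T (QWeylRel n q a b c) (FreeAlgebra.ι T 0)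

/-- The image of the generator `y`. -/
noncomputable def y {T : Type*} [CommRing T] (n : ℕ) (q a b c : T) : QWeylQuot n q a b c :=
  RingQuot.mkAlgHom T (QWeylRel n q a b c) (FreeAlgebra.ι T 1)

end QWeylQuot

/-- The element `m = ∏_{i=2}^{n-1} (1 + q + ⋯ + q^{i-1})`; it is `1` for `n ≤ 2`. -/
def qProd {T : Type*} [CommRing T] (n : ℕ) (q : T) : T :=
  ∏ i ∈ Finset.Ico 2 n, ∑ j ∈ Finset.range i, q ^ j

/-! Everything rests on the normal element `w = (1 - q)xy - a`, with `wx = qxw` and `yw = qwy`. Its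
power `w ^ n` is the scalar `D = ± ((1 - q) ^ n * b * c - a ^ n)` (`normalElt_pow`). Let `f` be the
coefficient of `x ^ (n-1) * y ^ (n-1)`. The form `f (st)` has unit determinant (`isUnit_det_top`),
and up to a power of `q` the trace of `s` is `nm * f (s * w ^ (n-1))` (`exists_trace_eq_top`). So
the discriminant is, up to a unit, `(nm) ^ (n^2)` times the `(n-1)`-st power of the determinant of
right multiplication by `w`. The `n`-th power of that determinant is `D ^ (n^2)`, so it equals `D ^
n` up to a power of `q`. -/

open Polynomial in
theorem IsPrimitiveRoot.prod_pow_mul_add {R : Type*} [CommRing R] [IsDomain R] {n : ℕ}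
    (hn : 0 < n) {p : R} (hp : IsPrimitiveRoot p n) (r s : R) :
    ∏ i ∈ Finset.range n, (p ^ i * r + s) = s ^ n - (-r) ^ n := by
  have h := congrArg (eval s) (X_pow_sub_C_eq_prod hp hn (rfl : (-r) ^ n = (-r) ^ n))
  simp only [eval_sub, eval_pow, eval_X, eval_C, eval_prod] at h
  rw [h]
  exact Finset.prod_congr rfl fun i _ => by ring

theorem IsPrimitiveRoot.exists_eq_pow_mul_of_pow_eq_pow {R : Type*} [CommRing R] [IsDomain R]
    {n : ℕ} (hn : 0 < n) {p : R} (hp : IsPrimitiveRoot p n) {r s : R} (h : s ^ n = r ^ n) :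
    ∃ i : ℕ, s = p ^ i * r := by
  have h' := hp.prod_pow_mul_add hn (-r) s
  rw [neg_neg, h, sub_self, Finset.prod_eq_zero_iff] at h'
  obtain ⟨i, -, hi⟩ := h'
  exact ⟨i, by linear_combination hi⟩

/-- Each factor of `∏ (1 - q ^ i) = n`, `0 < i < n`, is `1 - q` times a geometric sum. -/
theorem IsPrimitiveRoot.mul_qProd_mul {T : Type*} [CommRing T] [IsDomain T] {n : ℕ}
    (hn : 1 ≤ n) {q : T} (hq : IsPrimitiveRoot q n) :
    (n : T) * qProd n q * (1 - q) ^ (n - 1) = (n : T) ^ 2 := by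
  obtain ⟨k, rfl⟩ := Nat.exists_eq_add_of_le' hn
  have h := hq.prod_one_sub_pow_eq_order
  have h2 : ∏ i ∈ Finset.range k, (1 - q ^ (i + 1)) = qProd (k + 1) q * (1 - q) ^ k := by
    rcases k with _ | k
    · simp [qProd]
    · have hk : (1 - q) ^ k = ∏ _i ∈ Finset.range k, (1 - q) := by simp
      rw [Finset.prod_range_succ', qProd, Finset.prod_Ico_eq_prod_range,
        show k + 1 + 1 - 2 = k by omega, pow_succ (1 - q) k, ← mul_assoc]
      congr 1
      · rw [hk, ← Finset.prod_mul_distrib]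
        refine Finset.prod_congr rfl fun i _ => ?_
        rw [← geom_sum_mul_neg, add_comm 2 i]
      · simp
  rw [h2] at h
  rw [Nat.add_sub_cancel, mul_assoc, h]
  push_cast
  ring

/-! ### The normal element: commutation, powers and traces -/

namespace QWeyl

variable {T A : Type*} [CommRing T] [Ring A] [Algebra T A]

/-- The normal element `(1 - q)xy - a`, which commutes with `x` and `y` up to powers of `q`. -/
def normalElt (q a : T) (x y : A) : A := (1 - q) • (x * y) - a • (1 : A)

variable {q a : T} {x y : A}

theorem normalElt_mul_x (h : y * x = q • (x * y) + a • (1 : A)) :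
    normalElt q a x y * x = q • (x * normalElt q a x y) := by
  simp only [normalElt, sub_mul, mul_sub, smul_mul_assoc, mul_assoc, h, mul_add, mul_smul_comm,
    one_mul, mul_one]
  module

theorem y_mul_normalElt (h : y * x = q • (x * y) + a • (1 : A)) :
    y * normalElt q a x y = q • (normalElt q a x y * y) := by
  simp only [normalElt, sub_mul, mul_sub, smul_mul_assoc, mul_smul_comm, ← mul_assoc, h, add_mul,
    one_mul, mul_one]
  module

theorem normalElt_mul_x_pow (h : y * x = q • (x * y) + a • (1 : A)) (k : ℕ) :
    normalElt q a x y * x ^ k = q ^ k • (x ^ k * normalElt q a x y) := by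
  induction k with
  | zero => simp
  | succ k ih =>
    rw [pow_succ, ← mul_assoc, ih, smul_mul_assoc, mul_assoc, normalElt_mul_x h, mul_smul_comm,
      smul_smul, ← pow_succ, mul_assoc]

theorem y_mul_normalElt_pow (h : y * x = q • (x * y) + a • (1 : A)) (k : ℕ) :
    y * normalElt q a x y ^ k = q ^ k • (normalElt q a x y ^ k * y) := by
  induction k with
  | zero => simp
  | succ k ih =>
    rw [pow_succ, ← mul_assoc, ih, smul_mul_assoc, mul_assoc, y_mul_normalElt h, mul_smul_comm,
      smul_smul, ← pow_succ, mul_assoc]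

theorem exists_y_pow_succ_mul_x (h : y * x = q • (x * y) + a • (1 : A)) (k : ℕ) :
    ∃ t : T, y ^ (k + 1) * x = q ^ (k + 1) • (x * y ^ (k + 1)) + t • y ^ k := by
  induction k with
  | zero => exact ⟨a, by simpa using h⟩
  | succ k ih =>
    obtain ⟨t, ht⟩ := ih
    refine ⟨q ^ (k + 1) * a + t, ?_⟩
    rw [pow_succ' y (k + 1), mul_assoc, ht, mul_add, mul_smul_comm, mul_smul_comm, ← mul_assoc, h,
      ← pow_succ', add_mul, smul_mul_assoc, smul_mul_assoc, one_mul, mul_assoc, ← pow_succ']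
    module

theorem normalElt_mul_pow_mul_pow (h : y * x = q • (x * y) + a • (1 : A)) (k : ℕ) :
    normalElt q a x y * (x ^ k * y ^ k) =
      (q ^ k * (1 - q)) • (x ^ (k + 1) * y ^ (k + 1)) - (a * q ^ k) • (x ^ k * y ^ k) := by
  rw [← mul_assoc, normalElt_mul_x_pow h, smul_mul_assoc, normalElt, mul_assoc, sub_mul, mul_sub,
    smul_mul_assoc, smul_mul_assoc, one_mul, mul_assoc x y, ← pow_succ', mul_smul_comm,
    mul_smul_comm, ← mul_assoc (x ^ k) x, ← pow_succ]
  module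

theorem smul_y_mul_x (h : y * x = q • (x * y) + a • (1 : A)) :
    (1 - q) • (y * x) = q • normalElt q a x y + a • (1 : A) := by
  rw [h, normalElt]
  module

open Polynomial in
theorem x_mul_aeval (h : y * x = q • (x * y) + a • (1 : A)) {p : T} (hp : p * q = 1) (f : T[X]) :
    x * aeval (normalElt q a x y) f = aeval (normalElt q a x y) (f.comp (C p * X)) * x := by
  have hx : x * normalElt q a x y = (p • normalElt q a x y) * x := by
    rw [smul_mul_assoc, normalElt_mul_x h, smul_smul, hp, one_smul]
  rw [aeval_comp]
  have hw : aeval (normalElt q a x y) (C p * X) = p • normalElt q a x y := by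
    simp [Algebra.smul_def]
  rw [hw]
  induction f using Polynomial.induction_on' with
  | add f g hf hg => rw [map_add, map_add, mul_add, add_mul, hf, hg]
  | monomial k r =>
    have hk : SemiconjBy x (normalElt q a x y ^ k) ((p • normalElt q a x y) ^ k) :=
      SemiconjBy.pow_right hx k
    simp only [aeval_monomial, ← Algebra.smul_def, mul_smul_comm, smul_mul_assoc, hk.eq]

-- Moving `x` past `w` rescales `w` by `p = q⁻¹`, so each pair `x`, `y` peeled off adds one linear
-- factor in `w`. For `k = n` the product over all roots of unity collapses to a binomial.
open Polynomial in
theorem smul_x_pow_mul_y_pow (h : y * x = q • (x * y) + a • (1 : A)) {p : T} (hp : p * q = 1)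
    (k : ℕ) : (1 - q) ^ k • (x ^ k * y ^ k) =
      aeval (normalElt q a x y) (∏ i ∈ Finset.range k, (C p ^ i * X + C a)) := by
  induction k with
  | zero => simp
  | succ k ih =>
    have hxy : (1 - q) • (x * y) = aeval (normalElt q a x y) (X + C a) := by
      simp [normalElt, Algebra.algebraMap_eq_smul_one]
    have hk : (1 - q) ^ (k + 1) • (x ^ (k + 1) * y ^ (k + 1)) =
        (1 - q) • (x * ((1 - q) ^ k • (x ^ k * y ^ k)) * y) := by
      rw [pow_succ', pow_succ' x, pow_succ y, mul_smul, mul_smul_comm, smul_mul_assoc]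
      simp only [mul_assoc]
    rw [hk, ih, x_mul_aeval h hp, mul_assoc, ← mul_smul_comm, hxy, ← map_mul,
      Finset.prod_range_succ']
    congr 1
    rw [prod_comp, pow_zero, one_mul]
    congr 1
    refine Finset.prod_congr rfl fun i _ => ?_
    simp only [add_comp, mul_comp, pow_comp, C_comp, X_comp]
    ring

open Polynomial in
theorem normalElt_pow [IsDomain T] {n : ℕ} (hn : 0 < n) (hq : IsPrimitiveRoot q n)
    (h : y * x = q • (x * y) + a • (1 : A)) {b c : T} (hx : x ^ n = algebraMap T A b)
    (hy : y ^ n = algebraMap T A c) :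
    normalElt q a x y ^ n =
      algebraMap T A ((-1) ^ (n + 1) * ((1 - q) ^ n * b * c - a ^ n)) := by
  have hpq : q ^ (n - 1) * q = 1 := by rw [← pow_succ, Nat.sub_add_cancel hn, hq.pow_eq_one]
  have hp : IsPrimitiveRoot (q ^ (n - 1)) n := by
    refine hq.pow_of_coprime _ ?_
    obtain ⟨k, rfl⟩ := Nat.exists_eq_add_of_le' hn
    simp
  have h1 := smul_x_pow_mul_y_pow h hpq n
  rw [(hp.map_of_injective (C_injective)).prod_pow_mul_add hn, neg_pow] at h1
  simp only [map_sub, map_mul, map_pow, aeval_C, aeval_X, map_neg, map_one, hx, hy] at h1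
  have h2 : (-1 : A) ^ n * normalElt q a x y ^ n = algebraMap T A (a ^ n - (1 - q) ^ n * b * c) := by
    rw [map_sub, mul_assoc, map_mul _ ((1 - q) ^ n), ← Algebra.smul_def, map_mul, h1, map_pow]
    abel
  calc normalElt q a x y ^ n = (-1 : A) ^ n * ((-1 : A) ^ n * normalElt q a x y ^ n) := by
        rw [← mul_assoc, ← pow_add, (Even.add_self n).neg_one_pow, one_mul]
    _ = _ := by
        rw [h2, ← map_one (algebraMap T A), ← map_neg, ← map_pow, ← map_mul]
        congr 1
        ring

/-- In `normalElt_mul_pow_mul_pow` the leading coefficient `q ^ k * (1 - q)` is nonzero, so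
vanishing passes from powers of `w` to diagonal monomials without dividing in `T`. -/
theorem apply_normalElt_pow_mul [IsDomain T] {n : ℕ} (hq : IsPrimitiveRoot q n) (hn : 1 ≤ n)
    (h : y * x = q • (x * y) + a • (1 : A)) (f : A →ₗ[T] T)
    (hf : ∀ j < n, f (normalElt q a x y ^ j) = 0) (k j : ℕ) (hjk : j + k < n) :
    f (normalElt q a x y ^ j * (x ^ k * y ^ k)) = 0 := by
  induction k generalizing j with
  | zero => simpa using hf j hjk
  | succ k ih =>
    have h1 := ih (j + 1) (by omega)
    rw [pow_succ, mul_assoc, normalElt_mul_pow_mul_pow h, mul_sub, mul_smul_comm, mul_smul_comm,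
      map_sub, map_smul, map_smul, ih j (by omega), smul_zero, sub_zero, smul_eq_mul] at h1
    refine (mul_eq_zero.mp h1).resolve_left (mul_ne_zero (pow_ne_zero _ (hq.ne_zero (by omega))) ?_)
    exact sub_ne_zero.mpr (hq.ne_one (by omega)).symm

theorem trace_normalElt_pow [IsDomain T] {n : ℕ} (hq : IsPrimitiveRoot q n)
    (h : y * x = q • (x * y) + a • (1 : A)) (j : ℕ) (hj : j + 1 < n) :
    LinearMap.trace T A (LinearMap.mulLeft T (normalElt q a x y ^ (j + 1))) = 0 := by
  set w := normalElt q a x y with hw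
  let τ : A →ₗ[T] T := LinearMap.trace T A ∘ₗ (Algebra.lmul T A).toLinearMap
  have hτ (s t : A) : τ (s * t) = τ (t * s) := by
    simp only [τ, LinearMap.comp_apply, AlgHom.toLinearMap_apply, map_mul]
    exact LinearMap.trace_mul_comm T _ _
  -- Cyclicity moves `y` around and past `w ^ j`; both `(1 - q)xy` and `(1 - q)yx` are affine in
  -- `w`, which gives a two-term recursion whose second term vanishes at `j = 0`.
  have key (j : ℕ) : (1 - q ^ (j + 1)) * τ (w ^ (j + 1)) + a * (1 - q ^ j) * τ (w ^ j) = 0 := by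
    have h1 : τ (w ^ j * ((1 - q) • (x * y))) = q ^ j * τ (w ^ j * ((1 - q) • (y * x))) := by
      rw [mul_smul_comm, mul_smul_comm, map_smul, map_smul, ← mul_assoc, hτ, ← mul_assoc,
        y_mul_normalElt_pow h, smul_mul_assoc, map_smul, mul_assoc]
      simp only [smul_eq_mul]
      ring
    have h2 : (1 - q) • (x * y) = w + a • (1 : A) := by rw [hw, normalElt]; module
    rw [h2, smul_y_mul_x h, ← hw, mul_add, mul_add, mul_smul_comm, mul_smul_comm, mul_one,
      ← pow_succ] at h1
    simp only [map_add, map_smul, smul_eq_mul] at h1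
    linear_combination h1
  have main (j : ℕ) (hj : j + 1 < n) : τ (w ^ (j + 1)) = 0 := by
    have hne : 1 - q ^ (j + 1) ≠ 0 :=
      sub_ne_zero.mpr (hq.pow_ne_one_of_pos_of_lt (by omega) hj).symm
    induction j with
    | zero =>
      have := key 0
      simp only [pow_zero, sub_self, mul_zero, zero_mul, add_zero] at this
      exact (mul_eq_zero.mp this).resolve_left hne
    | succ j ih =>
      have := key (j + 1)
      rw [ih (by omega) (sub_ne_zero.mpr (hq.pow_ne_one_of_pos_of_lt (by omega) (by omega)).symm),
        mul_zero, add_zero] at this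
      exact (mul_eq_zero.mp this).resolve_left hne
  exact main j hj

end QWeyl

/-! ### The form given by the top coefficient, and the discriminant -/

theorem Module.Basis.isUnit_det_of_dual {R M ι κ : Type*} [CommRing R] [AddCommGroup M]
    [Module R M] [Fintype ι] [DecidableEq ι] [Fintype κ] [DecidableEq κ]
    (B : M →ₗ[R] M →ₗ[R] R) (β : Module.Basis κ R M) (v : κ → M)
    (hv : ∀ k l, B (β k) (v l) = if k = l then 1 else 0) (z : Module.Basis ι R M) (e : ι ≃ κ) :
    IsUnit (Matrix.of fun i j => B (z i) (z j)).det := by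
  have h : (Matrix.of fun i j => B (z i) (z j)) * z.toMatrix (v ∘ e) =
      ((β.reindex e.symm).toMatrix z).transpose := by
    ext i j
    have h1 : B (z i) (v (e j)) = β.repr (z i) (e j) := by
      conv_lhs => rw [← β.sum_repr (z i), map_sum, LinearMap.sum_apply]
      simp [hv]
    have h2 : B (z i) (v (e j)) = ∑ k, B (z i) (z k) * z.repr (v (e j)) k := by
      conv_lhs => rw [← z.sum_repr (v (e j)), map_sum]
      simp [mul_comm]
    simp [Matrix.mul_apply, Module.Basis.toMatrix_apply, ← h2, h1]
  have hu : IsUnit ((β.reindex e.symm).toMatrix z).transpose.det := by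
    rw [Matrix.det_transpose]
    refine IsUnit.of_mul_eq_one (z.toMatrix (β.reindex e.symm)).det ?_
    rw [← Matrix.det_mul, Module.Basis.toMatrix_mul_toMatrix_flip, Matrix.det_one]
  rw [← h, Matrix.det_mul] at hu
  exact isUnit_of_mul_isUnit_left hu

theorem LinearMap.trace_mulLeft_algEquiv {R A : Type*} [CommRing R] [Ring A] [Algebra R A]
    (θ : A ≃ₐ[R] A) (s : A) :
    LinearMap.trace R A (LinearMap.mulLeft R (θ s)) =
      LinearMap.trace R A (LinearMap.mulLeft R s) := by
  rw [← LinearMap.trace_conj' (LinearMap.mulLeft R s) θ.toLinearEquiv]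
  congr 1
  ext t
  simp [LinearEquiv.conj_apply]

namespace QWeyl

variable {T A : Type*} [CommRing T] [Ring A] [Algebra T A]
  {n : ℕ} {q a b c : T} {x y : A} {f : A →ₗ[T] T}

/-- Reducing an exponent in `[n, 2n - 2]` by `n` leaves at most `n - 2`, which misses the top
monomial. -/
theorem top_apply (hx : x ^ n = algebraMap T A b) (hy : y ^ n = algebraMap T A c)
    (hf : ∀ i < n, ∀ j < n, f (x ^ i * y ^ j) = if i = n - 1 ∧ j = n - 1 then 1 else 0)
    {i j : ℕ} (hi : i < 2 * n - 1) (hj : j < 2 * n - 1) :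
    f (x ^ i * y ^ j) = if i = n - 1 ∧ j = n - 1 then 1 else 0 := by
  have hfi (j : ℕ) (hj : j < n) : f (x ^ i * y ^ j) = if i = n - 1 ∧ j = n - 1 then 1 else 0 := by
    rcases lt_or_ge i n with h | h
    · exact hf i h j hj
    · obtain ⟨k, rfl⟩ := Nat.exists_eq_add_of_le h
      rw [pow_add, hx, mul_assoc, ← Algebra.smul_def, map_smul, hf k (by omega) j hj,
        if_neg (by omega), if_neg (by omega), smul_zero]
  rcases lt_or_ge j n with h | h
  · exact hfi j h
  · obtain ⟨k, rfl⟩ := Nat.exists_eq_add_of_le' h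
    rw [pow_add, hy, ← mul_assoc, ← Algebra.commutes, ← Algebra.smul_def, map_smul,
      hfi k (by omega), if_neg (by omega), if_neg (by omega), smul_zero]

theorem top_x_mul (hq : IsPrimitiveRoot q n)
    (h : y * x = q • (x * y) + a • (1 : A))
    (hx : x ^ n = algebraMap T A b) (hy : y ^ n = algebraMap T A c)
    (β : Module.Basis (Fin n × Fin n) T A) (hβ : ∀ i j : Fin n, β (i, j) = x ^ (i : ℕ) * y ^ (j : ℕ))
    (hf : ∀ i < n, ∀ j < n, f (x ^ i * y ^ j) = if i = n - 1 ∧ j = n - 1 then 1 else 0) (s : A) :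
    f (x * s) = q * f (s * x) := by
  suffices f ∘ₗ LinearMap.mulLeft T x = q • f ∘ₗ LinearMap.mulRight T x from
    LinearMap.congr_fun this s
  refine β.ext fun ⟨⟨i, hi⟩, ⟨j, hj⟩⟩ => ?_
  simp only [LinearMap.comp_apply, LinearMap.smul_apply, hβ, LinearMap.mulLeft_apply,
    LinearMap.mulRight_apply, smul_eq_mul]
  rcases eq_or_ne n 1 with rfl | hn
  · obtain rfl : i = 0 := by omega
    obtain rfl : j = 0 := by omega
    have : q = 1 := by simpa using hq.pow_eq_one
    simp [this]
  rcases j with _ | j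
  · have := top_apply hx hy hf (i := i + 1) (j := 0) (by omega) (by omega)
    rw [if_neg (by omega)] at this
    rw [pow_zero, mul_one] at this ⊢
    rw [← pow_succ', ← pow_succ, this, mul_zero]
  · obtain ⟨t, ht⟩ := exists_y_pow_succ_mul_x h j
    rw [mul_assoc, ht, mul_add, mul_smul_comm, mul_smul_comm, ← mul_assoc, ← mul_assoc, ← pow_succ',
      ← pow_succ, map_add, map_smul, map_smul, top_apply hx hy hf (by omega) (by omega),
      top_apply hx hy hf (by omega) (by omega), if_neg (by omega : ¬ (i = n - 1 ∧ j = n - 1)),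
      smul_zero, add_zero, smul_eq_mul]
    split_ifs with hij
    -- Passing `x` through `y ^ (n-1)` costs `q ^ (n-1)`, the inverse of the twist `q`.
    · rw [mul_one, ← pow_succ', show j + 1 + 1 = n by omega, hq.pow_eq_one]
    · simp

theorem top_x_pow_mul (hfx : ∀ s, f (x * s) = q * f (s * x)) (l : ℕ) (s : A) :
    f (x ^ l * s) = q ^ l * f (s * x ^ l) := by
  induction l generalizing s with
  | zero => simp
  | succ l ih => rw [pow_succ, mul_assoc, ih, mul_assoc, hfx, pow_succ, mul_assoc, mul_assoc]

theorem isUnit_det_top [Nontrivial T] (hq : IsPrimitiveRoot q n) (h : y * x = q • (x * y) + a • (1 : A))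
    (hx : x ^ n = algebraMap T A b) (hy : y ^ n = algebraMap T A c)
    (β : Module.Basis (Fin n × Fin n) T A) (hβ : ∀ i j : Fin n, β (i, j) = x ^ (i : ℕ) * y ^ (j : ℕ))
    (hf : ∀ i < n, ∀ j < n, f (x ^ i * y ^ j) = if i = n - 1 ∧ j = n - 1 then 1 else 0)
    {ι : Type*} [Fintype ι] [DecidableEq ι] (z : Module.Basis ι T A) :
    IsUnit (Matrix.of fun i j => f (z i * z j)).det := by
  refine Module.Basis.isUnit_det_of_dual ((LinearMap.mul T A).compr₂ f) β
    -- Dual family to the monomials: the twist brings the power of `x` to the front, and its factor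
    -- of `q` is the scalar put here.
    (fun k => q ^ (n - 1 - k.1) • (y ^ (n - 1 - k.2) * x ^ (n - 1 - k.1))) ?_ z (z.indexEquiv β)
  rintro ⟨⟨i, hi⟩, ⟨j, hj⟩⟩ ⟨⟨k, hk⟩, ⟨l, hl⟩⟩
  simp only [LinearMap.compr₂_apply, LinearMap.mul_apply', hβ, map_smul, smul_eq_mul]
  rw [← mul_assoc, ← top_x_pow_mul (top_x_mul hq h hx hy β hβ hf), ← mul_assoc, ← mul_assoc,
    ← pow_add, mul_assoc, ← pow_add, top_apply hx hy hf (by omega) (by omega)]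
  simp only [Prod.mk.injEq, Fin.mk.injEq]
  congr 1
  apply propext
  omega

theorem top_normalElt_pow_mul (hn : 1 ≤ n) (h : y * x = q • (x * y) + a • (1 : A))
    (hf : ∀ i < n, ∀ j < n, f (x ^ i * y ^ j) = if i = n - 1 ∧ j = n - 1 then 1 else 0)
    (j k : ℕ) (hjk : j + k < n - 1) :
    f (normalElt q a x y ^ j * (x ^ k * y ^ k)) = 0 := by
  induction j generalizing k with
  | zero => rw [pow_zero, one_mul, hf k (by omega) k (by omega), if_neg (by omega)]
  | succ j ih =>
    rw [pow_succ, mul_assoc, normalElt_mul_pow_mul_pow h, mul_sub, mul_smul_comm, mul_smul_comm,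
      map_sub, map_smul, map_smul, ih _ (by omega), ih _ (by omega), smul_zero, smul_zero, sub_zero]

theorem exists_top_normalElt_pow_mul (hn : 1 ≤ n) (h : y * x = q • (x * y) + a • (1 : A))
    (hf : ∀ i < n, ∀ j < n, f (x ^ i * y ^ j) = if i = n - 1 ∧ j = n - 1 then 1 else 0)
    (j k : ℕ) (hjk : j + k = n - 1) :
    ∃ e : ℕ, f (normalElt q a x y ^ j * (x ^ k * y ^ k)) = q ^ e * (1 - q) ^ j := by
  induction j generalizing k with
  | zero =>
    refine ⟨0, ?_⟩
    rw [pow_zero, one_mul, hf k (by omega) k (by omega), if_pos (by omega)]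
    simp
  | succ j ih =>
    obtain ⟨e, he⟩ := ih (k + 1) (by omega)
    refine ⟨k + e, ?_⟩
    rw [pow_succ, mul_assoc, normalElt_mul_pow_mul_pow h, mul_sub, mul_smul_comm, mul_smul_comm,
      map_sub, map_smul, map_smul, he, top_normalElt_pow_mul hn h hf j k (by omega), smul_zero,
      sub_zero, smul_eq_mul]
    ring

theorem apply_pow_mul_pow_eq_zero [IsDomain T] (hq : IsPrimitiveRoot q n) {p : T} (hp : p * q = 1)
    (θ : A ≃ₐ[T] A) (hθx : θ x = q • x) (hθy : θ y = p • y) (g : A →ₗ[T] T)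
    (hg : ∀ s, g (θ s) = g s) {i j : ℕ} (hi : i < n) (hj : j < n) (hij : i ≠ j) :
    g (x ^ i * y ^ j) = 0 := by
  have h := hg (x ^ i * y ^ j)
  rw [map_mul, map_pow, map_pow, hθx, hθy, smul_pow, smul_pow, smul_mul_smul_comm, map_smul,
    smul_eq_mul] at h
  have h1 : (q ^ i - q ^ j) * g (x ^ i * y ^ j) = 0 := by
    have hpq : p ^ j * q ^ j = 1 := by rw [← mul_pow, hp, one_pow]
    linear_combination q ^ j * h - q ^ i * g (x ^ i * y ^ j) * hpq
  exact (mul_eq_zero.mp h1).resolve_left (sub_ne_zero.mpr fun h => hij (hq.pow_inj hi hj h))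

theorem algEquiv_normalElt {p : T} (hp : p * q = 1) (θ : A ≃ₐ[T] A) (hθx : θ x = q • x)
    (hθy : θ y = p • y) : θ (normalElt q a x y) = normalElt q a x y := by
  simp only [normalElt, map_sub, map_smul, map_mul, map_one, hθx, hθy, smul_mul_smul_comm,
    mul_comm q p, hp, one_smul]

theorem top_algEquiv {p : T} (hp : p * q = 1)
    (β : Module.Basis (Fin n × Fin n) T A) (hβ : ∀ i j : Fin n, β (i, j) = x ^ (i : ℕ) * y ^ (j : ℕ))
    (hf : ∀ i < n, ∀ j < n, f (x ^ i * y ^ j) = if i = n - 1 ∧ j = n - 1 then 1 else 0)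
    (θ : A ≃ₐ[T] A) (hθx : θ x = q • x) (hθy : θ y = p • y) (s : A) : f (θ s) = f s := by
  suffices f ∘ₗ θ.toLinearMap = f from LinearMap.congr_fun this s
  refine β.ext fun ⟨⟨i, hi⟩, ⟨j, hj⟩⟩ => ?_
  simp only [hβ, LinearMap.comp_apply, AlgEquiv.toLinearMap_apply, map_mul, map_pow, hθx, hθy,
    smul_pow, smul_mul_smul_comm, map_smul, hf i hi j hj, smul_eq_mul]
  split_ifs with hij
  · rw [hij.1, hij.2, ← mul_pow, mul_comm q, hp, one_pow, one_mul]
  · simp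

/-- Both sides are invariant under `θ`, hence vanish off the diagonal monomials; on the diagonal it
suffices to compare them on `1, w, …, w ^ (n-1)`. -/
theorem exists_trace_eq_top [IsDomain T] (hn : 1 ≤ n) (hq : IsPrimitiveRoot q n)
    (h : y * x = q • (x * y) + a • (1 : A))
    (hx : x ^ n = algebraMap T A b) (hy : y ^ n = algebraMap T A c)
    (β : Module.Basis (Fin n × Fin n) T A) (hβ : ∀ i j : Fin n, β (i, j) = x ^ (i : ℕ) * y ^ (j : ℕ))
    (hf : ∀ i < n, ∀ j < n, f (x ^ i * y ^ j) = if i = n - 1 ∧ j = n - 1 then 1 else 0)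
    {p : T} (hp : p * q = 1) (θ : A ≃ₐ[T] A) (hθx : θ x = q • x) (hθy : θ y = p • y) :
    ∃ e : ℕ, ∀ s, q ^ e * LinearMap.trace T A (LinearMap.mulLeft T s) =
      (n : T) * qProd n q * f (s * normalElt q a x y ^ (n - 1)) := by
  set w := normalElt q a x y with hw
  obtain ⟨e, he⟩ := exists_top_normalElt_pow_mul hn h hf (n - 1) 0 (by omega)
  rw [pow_zero, pow_zero, mul_one, mul_one, ← hw] at he
  refine ⟨e, ?_⟩
  let τ : A →ₗ[T] T := LinearMap.trace T A ∘ₗ (Algebra.lmul T A).toLinearMap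
  have hτ (s : A) : τ s = LinearMap.trace T A (LinearMap.mulLeft T s) := rfl
  -- Scalars chosen so that `g 1 = 0`: the trace of `1` is `n ^ 2`, and `f (w ^ (n-1)) = q ^ e * (1
  -- - q) ^ (n-1)`.
  let g : A →ₗ[T] T := (q ^ e * (1 - q) ^ (n - 1)) • τ -
    ((n : T) ^ 2) • f ∘ₗ LinearMap.mulRight T (w ^ (n - 1))
  have hgs (s : A) : g s = q ^ e * (1 - q) ^ (n - 1) * τ s - (n : T) ^ 2 * f (s * w ^ (n - 1)) := rfl
  have hgw (j : ℕ) (hj : j < n) : g (w ^ j) = 0 := by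
    rw [hgs, hτ]
    rcases j with _ | j
    · have h1 : LinearMap.mulLeft T (1 : A) = 1 := by ext; simp
      rw [pow_zero, h1, one_mul, he]
      have := Module.Free.of_basis β
      have := Module.Finite.of_basis β
      rw [LinearMap.trace_one, Module.finrank_eq_card_basis β]
      simp only [Fintype.card_prod, Fintype.card_fin]
      push_cast
      ring
    · have h0 := top_normalElt_pow_mul hn h hf j 0 (by omega)
      rw [pow_zero, pow_zero, mul_one, mul_one, ← hw] at h0
      rw [trace_normalElt_pow hq h j hj, ← pow_add, show j + 1 + (n - 1) = n + j by omega, pow_add,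
        normalElt_pow hn hq h hx hy, ← Algebra.smul_def, map_smul, h0]
      simp
  have hg0 : g = 0 := by
    refine β.ext fun ⟨⟨i, hi⟩, ⟨j, hj⟩⟩ => ?_
    rw [hβ, LinearMap.zero_apply]
    rcases eq_or_ne i j with rfl | hij
    · simpa using apply_normalElt_pow_mul hq hn h g hgw i 0 (by omega)
    · refine apply_pow_mul_pow_eq_zero hq hp θ hθx hθy g (fun s => ?_) hi hj hij
      rw [hgs, hgs, hτ, hτ, LinearMap.trace_mulLeft_algEquiv]
      congr 2
      conv_lhs => rw [hw, ← algEquiv_normalElt hp θ hθx hθy, ← map_pow, ← map_mul]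
      exact top_algEquiv hp β hβ hf θ hθx hθy _
  intro s
  have h1 := LinearMap.congr_fun hg0 s
  rw [hgs, hτ, LinearMap.zero_apply, ← hq.mul_qProd_mul hn] at h1
  have hne : (1 - q) ^ (n - 1) ≠ 0 := by
    rcases eq_or_ne n 1 with rfl | hn1
    · simp
    · exact pow_ne_zero _ (sub_ne_zero.mpr (hq.ne_one (by omega)).symm)
  refine mul_left_cancel₀ hne ?_
  linear_combination h1

theorem exists_det_mulRight_normalElt [IsDomain T] (hn : 1 ≤ n) (hq : IsPrimitiveRoot q n)
    (h : y * x = q • (x * y) + a • (1 : A))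
    (hx : x ^ n = algebraMap T A b) (hy : y ^ n = algebraMap T A c)
    (β : Module.Basis (Fin n × Fin n) T A) :
    ∃ s : ℕ, LinearMap.det (LinearMap.mulRight T (normalElt q a x y)) =
      q ^ s * ((-1) ^ (n + 1) * ((1 - q) ^ n * b * c - a ^ n)) ^ n := by
  refine hq.exists_eq_pow_mul_of_pow_eq_pow hn ?_
  have := Module.Free.of_basis β
  have h1 (r : T) : LinearMap.mulRight T (algebraMap T A r) = r • (1 : Module.End T A) := by
    ext s
    simp [Algebra.smul_def, Algebra.commutes]
  rw [← map_pow, LinearMap.pow_mulRight, normalElt_pow hn hq h hx hy, h1, LinearMap.det_smul,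
    Module.finrank_eq_card_basis β, map_one, mul_one, ← pow_mul]
  simp

theorem exists_ncDiscr_eq [IsDomain T] (hn : 1 ≤ n) (hq : IsPrimitiveRoot q n)
    (h : y * x = q • (x * y) + a • (1 : A))
    (hx : x ^ n = algebraMap T A b) (hy : y ^ n = algebraMap T A c)
    (β : Module.Basis (Fin n × Fin n) T A) (hβ : ∀ i j : Fin n, β (i, j) = x ^ (i : ℕ) * y ^ (j : ℕ))
    {p : T} (hp : p * q = 1) (θ : A ≃ₐ[T] A) (hθx : θ x = q • x) (hθy : θ y = p • y)
    {ι : Type*} [Fintype ι] [DecidableEq ι] (z : Module.Basis ι T A) :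
    ∃ u : Tˣ, ncDiscr T z = u * ((n : T) * qProd n q) ^ n ^ 2 *
      ((1 - q) ^ n * b * c - a ^ n) ^ (n * (n - 1)) := by
  let top : Fin n := ⟨n - 1, by omega⟩
  let f : A →ₗ[T] T := β.coord (top, top)
  have hf : ∀ i < n, ∀ j < n, f (x ^ i * y ^ j) = if i = n - 1 ∧ j = n - 1 then 1 else 0 := by
    intro i hi j hj
    have hij := hβ ⟨i, hi⟩ ⟨j, hj⟩
    simp only at hij
    rw [← hij]
    simp [f, top, Module.Basis.coord_apply, Finsupp.single_apply]
  obtain ⟨e, he⟩ := exists_trace_eq_top hn hq h hx hy β hβ hf hp θ hθx hθy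
  obtain ⟨s, hs⟩ := exists_det_mulRight_normalElt hn hq h hx hy β
  obtain ⟨v, hv⟩ := isUnit_det_top hq h hx hy β hβ hf z
  set w := normalElt q a x y with hw
  have hcard : Fintype.card ι = n ^ 2 := by
    rw [Fintype.card_congr (z.indexEquiv β)]
    simp [sq]
  -- The trace matrix is the matrix of `f` times that of right multiplication by `w ^ (n-1)`, up to
  -- scalars.
  have hmat : q ^ e • (Matrix.of fun i j : ι =>
        LinearMap.trace T A (LinearMap.mulLeft T (z i * z j))) =
      ((n : T) * qProd n q) • ((Matrix.of fun i j => f (z i * z j)) *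
        LinearMap.toMatrix z z (LinearMap.mulRight T (w ^ (n - 1)))) := by
    ext i j
    simp only [Matrix.smul_apply, Matrix.of_apply, smul_eq_mul, he, Matrix.mul_apply,
      LinearMap.toMatrix_apply, LinearMap.mulRight_apply]
    congr 1
    conv_lhs => rw [mul_assoc, ← z.sum_repr (z j * w ^ (n - 1)), Finset.mul_sum, map_sum]
    refine Finset.sum_congr rfl fun k _ => ?_
    rw [mul_smul_comm, map_smul, smul_eq_mul, mul_comm]
  have hdet := congrArg Matrix.det hmat
  rw [Matrix.det_smul, Matrix.det_smul, Matrix.det_mul, LinearMap.det_toMatrix, ← hv,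
    ← LinearMap.pow_mulRight, map_pow, hs, hcard] at hdet
  obtain ⟨q', rfl⟩ := hq.isUnit (by omega)
  refine ⟨(q' ^ e)⁻¹ ^ n ^ 2 * v * (q' ^ s * ((-1) ^ (n + 1)) ^ n) ^ (n - 1), ?_⟩
  have hinv : (((q' ^ e)⁻¹ ^ n ^ 2 : Tˣ) : T) * ((q' : T) ^ e) ^ n ^ 2 = 1 := by
    rw [← Units.val_pow_eq_pow_val, ← Units.val_pow_eq_pow_val, ← Units.val_mul, ← mul_pow,
      inv_mul_cancel, one_pow, Units.val_one]
  have hcancel (d : T) :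
      d = (((q' ^ e)⁻¹ ^ n ^ 2 : Tˣ) : T) * (((q' : T) ^ e) ^ n ^ 2 * d) := by
    rw [← mul_assoc, hinv, one_mul]
  rw [ncDiscr, hcancel (Matrix.det _), hdet]
  simp only [Units.val_mul, Units.val_pow_eq_pow_val, Units.val_neg, Units.val_one, mul_pow, pow_mul]
  ring

end QWeyl

/-! ### Relations and scaling automorphisms of the presented algebra -/

namespace QWeylQuot

variable {T : Type*} [CommRing T] (n : ℕ) (q a b c : T)

theorem y_mul_x : y n q a b c * x n q a b c = q • (x n q a b c * y n q a b c) + a • 1 := by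
  have h := RingQuot.mkAlgHom_rel T (QWeylRel.comm (n := n) (q := q) (a := a) (b := b) (c := c))
  rw [map_sub, map_smul, map_mul, map_mul, AlgHom.commutes, Algebra.algebraMap_eq_smul_one] at h
  exact sub_eq_iff_eq_add'.mp h

theorem x_pow : x n q a b c ^ n = algebraMap T _ b := by
  have h := RingQuot.mkAlgHom_rel T (QWeylRel.x_pow (n := n) (q := q) (a := a) (b := b) (c := c))
  rwa [map_pow, AlgHom.commutes] at h

theorem y_pow : y n q a b c ^ n = algebraMap T _ c := by
  have h := RingQuot.mkAlgHom_rel T (QWeylRel.y_pow (n := n) (q := q) (a := a) (b := b) (c := c))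
  rwa [map_pow, AlgHom.commutes] at h

/-- The endomorphism `x ↦ rx`, `y ↦ sy` for mutually inverse `n`-th roots of unity `r`, `s`. -/
noncomputable def scaleHom (r s : T) (hrs : r * s = 1) (hr : r ^ n = 1) (hs : s ^ n = 1) :
    QWeylQuot n q a b c →ₐ[T] QWeylQuot n q a b c :=
  RingQuot.liftAlgHom T ⟨FreeAlgebra.lift T ![r • x n q a b c, s • y n q a b c], by
    have h0 : FreeAlgebra.lift T ![r • x n q a b c, s • y n q a b c] (FreeAlgebra.ι T 0) =
      r • x n q a b c := by simp
    have h1 : FreeAlgebra.lift T ![r • x n q a b c, s • y n q a b c] (FreeAlgebra.ι T 1) =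
      s • y n q a b c := by simp
    intro u v huv
    cases huv with
    | comm =>
      rw [map_sub, map_smul, map_mul, map_mul, h0, h1, AlgHom.commutes, smul_mul_smul_comm,
        smul_mul_smul_comm, mul_comm s r, hrs, one_smul, one_smul, y_mul_x, add_sub_cancel_left,
        Algebra.algebraMap_eq_smul_one]
    | x_pow => rw [map_pow, h0, AlgHom.commutes, smul_pow, hr, one_smul, x_pow]
    | y_pow => rw [map_pow, h1, AlgHom.commutes, smul_pow, hs, one_smul, y_pow]⟩

variable {n q a b c} {r s : T} (hrs : r * s = 1) (hr : r ^ n = 1) (hs : s ^ n = 1)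

theorem scaleHom_x : scaleHom n q a b c r s hrs hr hs (x n q a b c) = r • x n q a b c := by
  rw [x, scaleHom, RingQuot.liftAlgHom_mkAlgHom_apply]
  simp [x]

theorem scaleHom_y : scaleHom n q a b c r s hrs hr hs (y n q a b c) = s • y n q a b c := by
  rw [y, scaleHom, RingQuot.liftAlgHom_mkAlgHom_apply]
  simp [y]

theorem algHom_ext {A : Type*} [Semiring A] [Algebra T A] {φ ψ : QWeylQuot n q a b c →ₐ[T] A}
    (hx : φ (x n q a b c) = ψ (x n q a b c)) (hy : φ (y n q a b c) = ψ (y n q a b c)) : φ = ψ := by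
  refine RingQuot.ringQuot_ext' T _ _ (FreeAlgebra.hom_ext (funext fun i => ?_))
  fin_cases i
  · exact hx
  · exact hy

theorem scaleHom_comp_scaleHom (hsr : s * r = 1) :
    (scaleHom n q a b c r s hrs hr hs).comp (scaleHom n q a b c s r hsr hs hr) =
      AlgHom.id T _ := by
  apply algHom_ext
  · simp only [AlgHom.comp_apply, scaleHom_x, map_smul, smul_smul, hsr, one_smul, AlgHom.id_apply]
  · simp only [AlgHom.comp_apply, scaleHom_y, map_smul, smul_smul, hrs, one_smul, AlgHom.id_apply]

end QWeylQuot

theorem theorem2p6 {T : Type*} [CommRing T] [IsDomain T] (n : ℕ) (hn : 1 ≤ n)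
    (q : T) (hq : IsPrimitiveRoot q n) (a b c : T)
    (hfree : ∃ β : Module.Basis (Fin n × Fin n) T (QWeylQuot n q a b c), ∀ i j : Fin n,
      β (i, j) = QWeylQuot.x n q a b c ^ (i : ℕ) * QWeylQuot.y n q a b c ^ (j : ℕ))
    {ι : Type*} [Fintype ι] [DecidableEq ι] (z : Module.Basis ι T (QWeylQuot n q a b c)) :
    ∃ u : Tˣ,
      algebraMap T (QWeylQuot n q a b c) (ncDiscr T z) =
        algebraMap T (QWeylQuot n q a b c) ((u : T) * ((n : T) * qProd n q) ^ n ^ 2) *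
          (algebraMap T (QWeylQuot n q a b c) ((1 - q) ^ n) *
              QWeylQuot.x n q a b c ^ n * QWeylQuot.y n q a b c ^ n -
            algebraMap T (QWeylQuot n q a b c) (a ^ n)) ^ (n * (n - 1)) := by
  obtain ⟨β, hβ⟩ := hfree
  have hp : q ^ (n - 1) * q = 1 := by rw [← pow_succ, Nat.sub_add_cancel hn, hq.pow_eq_one]
  have hp' : q * q ^ (n - 1) = 1 := by rw [mul_comm, hp]
  have hpn : (q ^ (n - 1)) ^ n = 1 := by rw [pow_right_comm, hq.pow_eq_one, one_pow]
  -- The grading automorphism `x ↦ qx`, `y ↦ q⁻¹y`, with `q⁻¹` written `q ^ (n-1)`.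
  let θ : QWeylQuot n q a b c ≃ₐ[T] QWeylQuot n q a b c :=
    AlgEquiv.ofAlgHom (QWeylQuot.scaleHom n q a b c q (q ^ (n - 1)) hp' hq.pow_eq_one hpn)
      (QWeylQuot.scaleHom n q a b c (q ^ (n - 1)) q hp hpn hq.pow_eq_one)
      (QWeylQuot.scaleHom_comp_scaleHom _ _ _ _) (QWeylQuot.scaleHom_comp_scaleHom _ _ _ _)
  obtain ⟨u, hu⟩ := QWeyl.exists_ncDiscr_eq hn hq (QWeylQuot.y_mul_x n q a b c)
    (QWeylQuot.x_pow n q a b c) (QWeylQuot.y_pow n q a b c) β hβ hp θ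
    (QWeylQuot.scaleHom_x hp' hq.pow_eq_one hpn) (QWeylQuot.scaleHom_y hp' hq.pow_eq_one hpn) z
  refine ⟨u, ?_⟩
  rw [hu, QWeylQuot.x_pow, QWeylQuot.y_pow]
  simp only [map_mul, map_sub, map_pow]
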